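/- For an integer $n\ge 0$ let $X_n=\zeta_{2^{n+2}}+\zeta_{2^{n+2}}^{-1}=2\cos(\pi/2^{n+1})$, where $\zeta_m=e^{2\pi\sqrt{-1}/m}$, and let $\mathbb{B}_n=\mathbb{Q}(X_n)\subset\mathbb{R}$, the $n$-th layer of the cyclotomic $\mathbb{Z}_2$-extension of $\mathbb{Q}$. Let $E_n$ be the group of units of the ring of integers of $\mathbb{B}_n$. For $n\ge 1$ let $N_{n/n-1}:E_n\to E_{n-1}$ be the relative norm map of $\mathbb{B}_n/\mathbb{B}_{n-1}$ and let $RE_n^+=\ker N_{n/n-1}$ be the group of relative units. Theorem. Let $n\ge 1$ and let $\epsilon$ be the real number $\epsilon=\frac{X_n+1}{X_n-1}>1$. Then $\epsilon\in RE_n^+$, and for every reduced fraction $\frac{l}{m}$ with $m\ge 1$, $l\neq 0$ and $\left|\frac{l}{m}\right|<1$, the positive real number $\epsilon^{l/m}$ does not belong to $RE_n^+$. -/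

import Mathlib

open NumberField

namespace WeberUnits

/-- `X n = ζ + ζ⁻¹ = 2 cos (2π / 2 ^ (n + 2))`, where `ζ = exp (2πi / 2 ^ (n + 2))`. -/
noncomputable def X (n : ℕ) : ℝ := 2 * Real.cos (Real.pi / 2 ^ (n + 1))

/-- `X n` is the sum of the primitive root of unity `exp (2πi / 2 ^ (n + 2))` and its inverse. -/
theorem X_eq_zeta_add_inv (n : ℕ) :
    (X n : ℂ) = Complex.exp (2 * Real.pi * Complex.I / 2 ^ (n + 2)) +
      (Complex.exp (2 * Real.pi * Complex.I / 2 ^ (n + 2)))⁻¹ := by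
  have h : (2 * Real.pi * Complex.I / 2 ^ (n + 2) : ℂ) = (Real.pi / 2 ^ (n + 1)) * Complex.I := by
    rw [pow_succ]; field_simp
  rw [h, ← Complex.exp_neg, X]
  push_cast
  rw [Complex.two_cos]
  simp [neg_mul]

/-- `X n` is the nested radical `√(2 + √(2 + ⋯ + √2))` with `n` twos. -/
theorem X_eq_sqrtTwoAddSeries (n : ℕ) : X n = Real.sqrtTwoAddSeries 0 n := by
  rw [X, Real.cos_pi_over_two_pow]; ring

theorem X_sq (n : ℕ) : X (n + 1) ^ 2 = X n + 2 := by
  have h : Real.pi / 2 ^ (n + 1) = 2 * (Real.pi / 2 ^ (n + 1 + 1)) := by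
    rw [pow_succ (2 : ℝ) (n + 1)]; field_simp
  rw [X, X, h, Real.cos_two_mul]; ring

theorem isIntegral_X (n : ℕ) : IsIntegral ℤ (X n) := by
  induction n with
  | zero => simpa [X] using (isIntegral_zero : IsIntegral ℤ (0 : ℝ))
  | succ k ih =>
    refine IsIntegral.of_pow (n := 2) two_pos ?_
    rw [X_sq]
    exact ih.add (isIntegral_algebraMap (R := ℤ) (x := (2 : ℤ)))

/-- The `n`-th layer `ℚ(X n)` of the cyclotomic `ℤ₂`-extension of `ℚ`, as a subfield of `ℝ`. -/
noncomputable def B (n : ℕ) : IntermediateField ℚ ℝ := IntermediateField.adjoin ℚ {X n}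

theorem X_mem_B (n : ℕ) : X n ∈ B n :=
  IntermediateField.subset_adjoin ℚ {X n} rfl

theorem B_pred_le (n : ℕ) : B (n - 1) ≤ B n := by
  rcases n with _ | k
  · exact le_refl _
  · refine IntermediateField.adjoin_le_iff.mpr ?_
    rintro x rfl
    have h : X k = X (k + 1) ^ 2 - 2 := by rw [X_sq]; ring
    change X k ∈ B (k + 1)
    rw [h]
    exact sub_mem (pow_mem (X_mem_B _) 2) (ofNat_mem (B (k + 1)) 2)

instance finiteDimensional_B (n : ℕ) : FiniteDimensional ℚ (B n) :=
  IntermediateField.adjoin.finiteDimensional (isIntegral_X n).tower_top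

instance numberField_B (n : ℕ) : NumberField (B n) where
  to_charZero := inferInstance
  to_finiteDimensional := finiteDimensional_B n

/-- The relative norm `N_{n/n-1}` from the units of (the ring of integers of) `B n` to those of
`B (n - 1)`; it is meant for `1 ≤ n`. -/
noncomputable def relNorm (n : ℕ) : (𝓞 (B n))ˣ →* (𝓞 (B (n - 1)))ˣ :=
  letI : Algebra (B (n - 1)) (B n) :=
    (IntermediateField.inclusion (B_pred_le n)).toRingHom.toAlgebra
  Units.map (RingOfIntegers.norm (B (n - 1)) (L := B n))

/-- The group of relative units `RE_n⁺ = ker N_{n/n-1}`. -/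
noncomputable def relUnits (n : ℕ) : Subgroup (𝓞 (B n))ˣ := (relNorm n).ker

/-- The real number `ε = (X n + 1) / (X n - 1)`. -/
noncomputable def eps (n : ℕ) : ℝ := (X n + 1) / (X n - 1)

/-- The real number `x` is (the value of) an element of `RE_n⁺`. -/
def IsRelUnit (n : ℕ) (x : ℝ) : Prop := ∃ u ∈ relUnits n, (((u : 𝓞 (B n)) : B n) : ℝ) = x

end WeberUnits

theorem sq_sub_trace_mul_add_norm_eq_zero {K L : Type*} [Field K] [Field L] [Algebra K L]
    (h : Module.finrank K L = 2) (x : L) :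
    x ^ 2 - algebraMap K L (Algebra.trace K L x) * x + algebraMap K L (Algebra.norm K x) = 0 := by
  have : FiniteDimensional K L := Module.finite_of_finrank_eq_succ h
  let b := Module.finBasisOfFinrankEq K L h
  apply Algebra.leftMulMatrix_injective b
  rw [Algebra.trace_eq_matrix_trace b, Algebra.norm_eq_matrix_det b]
  simp only [map_add, map_sub, map_mul, map_pow, map_zero, AlgHom.commutes]
  generalize Algebra.leftMulMatrix b x = M
  ext i j
  fin_cases i <;> fin_cases j <;>
    simp [Matrix.trace_fin_two, Matrix.det_fin_two, pow_two, Matrix.mul_apply,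
      Matrix.algebraMap_matrix_apply] <;> ring

theorem one_lt_geom_sum_sq {r : ℝ} (hr : r ≠ 0) {m : ℕ} (hm : 2 ≤ m) :
    1 < ∑ j ∈ Finset.range m, (r ^ 2) ^ j := by
  have hs : ∑ j ∈ Finset.range 2, (r ^ 2) ^ j ≤ ∑ j ∈ Finset.range m, (r ^ 2) ^ j :=
    Finset.sum_le_sum_of_subset_of_nonneg (Finset.range_subset_range.mpr hm)
      fun _ _ _ => by positivity
  have : 0 < r ^ 2 := by positivity
  rw [Finset.sum_range_succ, Finset.sum_range_one] at hs
  linarith [pow_zero (r ^ 2), pow_one (r ^ 2)]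

section

variable {K : Type*} [Field K] [NumberField K]

theorem dvd_or_dvd_sub_one_of_abs_norm_eq_two {p : 𝓞 K} (hp : |Algebra.norm ℚ (p : K)| = 2)
    (x : 𝓞 K) : p ∣ x ∨ p ∣ x - 1 := by
  have hc : Nat.card (𝓞 K ⧸ Ideal.span {p}) = 2 := by
    change Ideal.absNorm (Ideal.span {p}) = 2
    rw [Ideal.absNorm_span_singleton]
    rw [← Algebra.coe_norm_int, ← Int.cast_abs, Int.abs_eq_natAbs] at hp
    exact_mod_cast hp
  have hp1 : (Ideal.Quotient.mk (Ideal.span {p}) 1) ≠ 0 := by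
    have : Nontrivial (𝓞 K ⧸ Ideal.span {p}) :=
      (Nat.card_eq_two_iff.mp hc).elim fun a ⟨b, h, _⟩ => ⟨a, b, h⟩
    rw [map_one]
    exact one_ne_zero
  rw [← Ideal.mem_span_singleton, ← Ideal.mem_span_singleton, ← Ideal.Quotient.eq_zero_iff_mem,
    ← Ideal.Quotient.eq_zero_iff_mem, map_sub, sub_eq_zero]
  by_contra! h
  obtain ⟨a, b, hab, hu⟩ := Nat.card_eq_two_iff.mp hc
  have hmem : ∀ y, y = a ∨ y = b := fun y => by
    simpa using (hu ▸ Set.mem_univ y : y ∈ ({a, b} : Set _))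
  have h1 := hmem (Ideal.Quotient.mk _ x)
  have h2 := hmem (Ideal.Quotient.mk _ 1)
  have h3 := hmem 0
  grind

theorem abs_norm_gt_one_of_geom_sum_sq (hK : ∀ (φ : K →ₐ[ℚ] ℂ) (x : K), ∃ r : ℝ, φ x = r)
    {x : K} (hx : x ≠ 0) {m : ℕ} (hm : 2 ≤ m) :
    1 < |Algebra.norm ℚ (∑ j ∈ Finset.range m, (x ^ 2) ^ j)| := by
  have hφ : ∀ φ : K →ₐ[ℚ] ℂ, 1 < ‖φ (∑ j ∈ Finset.range m, (x ^ 2) ^ j)‖ := by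
    intro φ
    obtain ⟨r, hr⟩ := hK φ x
    have hr0 : r ≠ 0 := by
      rintro rfl
      exact hx ((map_eq_zero φ).mp (by simpa using hr))
    have : φ (∑ j ∈ Finset.range m, (x ^ 2) ^ j) =
        ((∑ j ∈ Finset.range m, (r ^ 2) ^ j : ℝ) : ℂ) := by
      simp [hr]
    rw [this, Complex.norm_real, Real.norm_eq_abs]
    exact (one_lt_geom_sum_sq hr0 hm).trans_le (le_abs_self _)
  have h := congrArg norm (Algebra.norm_eq_prod_embeddings ℚ ℂ
    (∑ j ∈ Finset.range m, (x ^ 2) ^ j))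
  rw [norm_prod, eq_ratCast, Complex.norm_ratCast] at h
  have hne : (Finset.univ : Finset (K →ₐ[ℚ] ℂ)).Nonempty :=
    ⟨IsAlgClosed.lift, Finset.mem_univ _⟩
  have := Finset.prod_lt_prod_of_nonempty (f := fun _ => (1 : ℝ)) (fun _ _ => one_pos)
    (fun φ _ => hφ φ) hne
  rw [Finset.prod_const_one, ← h] at this
  exact_mod_cast this

theorem not_pow_sub_one_dvd_of_odd (hK : ∀ (φ : K →ₐ[ℚ] ℂ) (x : K), ∃ r : ℝ, φ x = r)
    {p : 𝓞 K} (hp : |Algebra.norm ℚ (p : K)| = 2) {k : ℕ} (hk : 2 ∣ p ^ k) (u : (𝓞 K)ˣ)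
    {m : ℕ} (hm : 2 ≤ m) (hodd : Odd m) : ¬ ((u : 𝓞 K) ^ 2) ^ m - 1 ∣ 4 * p := by
  intro hdvd
  set κ : 𝓞 K := ∑ j ∈ Finset.range m, ((u : 𝓞 K) ^ 2) ^ j with hκ
  have hpu : ¬ IsUnit p := fun h => by
    have := NumberField.isUnit_iff_norm.mp h
    rw [RingOfIntegers.coe_norm, hp] at this
    norm_num at this
  have hres := dvd_or_dvd_sub_one_of_abs_norm_eq_two hp
  have hp2 : p ∣ 2 := (hres 2).resolve_right fun h => hpu <|
    isUnit_of_dvd_one (by norm_num at h; exact h)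
  have hu1 : p ∣ (u : 𝓞 K) ^ 2 - 1 :=
    (hres _).resolve_left fun h => hpu (isUnit_of_dvd_unit h (u.isUnit.pow 2))
  have hκ1 : p ∣ κ - 1 := by
    obtain ⟨c, rfl⟩ := hodd
    have h1 : p ∣ κ - (2 * c + 1 : ℕ) := by
      have : κ - (2 * c + 1 : ℕ) = ∑ j ∈ Finset.range (2 * c + 1), (((u : 𝓞 K) ^ 2) ^ j - 1) := by
        rw [Finset.sum_sub_distrib]; simp [hκ]
      rw [this]
      exact Finset.dvd_sum fun j _ => hu1.trans <| by
        simpa using sub_dvd_pow_sub_pow ((u : 𝓞 K) ^ 2) 1 j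
    have h2 := dvd_add h1 (hp2.mul_right (c : 𝓞 K))
    push_cast at h2
    convert h2 using 1
    ring
  have hcop : IsCoprime κ p := by
    obtain ⟨s, hs⟩ := hκ1
    exact ⟨1, -s, by linear_combination hs⟩
  have hcop2 : IsCoprime κ 2 := by
    obtain ⟨s, hs⟩ := hk
    exact (hs ▸ hcop.pow_right (n := k) : IsCoprime κ (2 * s)).of_mul_right_left
  have hκdvd : κ ∣ 2 * 2 * p := by
    refine Dvd.dvd.trans ⟨(u : 𝓞 K) ^ 2 - 1, (geom_sum_mul _ m).symm⟩ (hdvd.trans ?_)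
    norm_num
  have hunit : IsUnit κ :=
    ((hcop2.mul_right hcop2).mul_right hcop).isUnit_of_dvd' dvd_rfl hκdvd
  have hn := NumberField.isUnit_iff_norm.mp hunit
  rw [RingOfIntegers.coe_norm] at hn
  have := abs_norm_gt_one_of_geom_sum_sq hK (x := ((u : 𝓞 K) : K))
    (RingOfIntegers.coe_ne_zero_iff.mpr u.ne_zero) hm
  have hcast : ((κ : 𝓞 K) : K) = ∑ j ∈ Finset.range m, (((u : 𝓞 K) : K) ^ 2) ^ j := by
    simp [hκ]
  rw [← hcast, hn] at this
  exact lt_irrefl _ this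

end

namespace WeberUnits

/-- The minimal polynomial of `X n`. -/
noncomputable def layerPoly : ℕ → Polynomial ℤ
  | 0 => Polynomial.X
  | n + 1 => (layerPoly n).comp (Polynomial.X ^ 2 - 2)

theorem natDegree_X_sq_sub_two : (Polynomial.X ^ 2 - 2 : Polynomial ℤ).natDegree = 2 :=
  Polynomial.natDegree_X_pow_sub_C (r := (2 : ℤ))

theorem monic_layerPoly (n : ℕ) : (layerPoly n).Monic := by
  induction n with
  | zero => exact Polynomial.monic_X
  | succ n ih =>
    refine ih.comp (Polynomial.monic_X_pow_sub_C (2 : ℤ) two_ne_zero) ?_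
    rw [natDegree_X_sq_sub_two]
    exact two_ne_zero

theorem natDegree_layerPoly (n : ℕ) : (layerPoly n).natDegree = 2 ^ n := by
  induction n with
  | zero => exact Polynomial.natDegree_X
  | succ n ih => rw [layerPoly, Polynomial.natDegree_comp, natDegree_X_sq_sub_two, ih, pow_succ]

theorem aeval_layerPoly_succ {R : Type*} [CommRing R] (n : ℕ) (x : R) :
    Polynomial.aeval x (layerPoly (n + 1)) = Polynomial.aeval (x ^ 2 - 2) (layerPoly n) := by
  rw [layerPoly, Polynomial.aeval_comp]
  simp [map_ofNat]

theorem eval_layerPoly_succ (n : ℕ) (x : ℤ) :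
    (layerPoly (n + 1)).eval x = (layerPoly n).eval (x ^ 2 - 2) := by
  simp [layerPoly, Polynomial.eval_comp]

theorem aeval_X_layerPoly (n : ℕ) : Polynomial.aeval (X n) (layerPoly n) = 0 := by
  induction n with
  | zero => simp [layerPoly, X]
  | succ n ih => rwa [aeval_layerPoly_succ, X_sq, add_sub_cancel_right]

theorem eval_two_layerPoly (n : ℕ) : (layerPoly n).eval 2 = 2 := by
  induction n with
  | zero => simp [layerPoly]
  | succ n ih => rw [eval_layerPoly_succ]; norm_num [ih]

theorem natAbs_eval_neg_two_layerPoly (n : ℕ) : ((layerPoly n).eval (-2)).natAbs = 2 := by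
  cases n with
  | zero => simp [layerPoly]
  | succ n => rw [eval_layerPoly_succ]; norm_num [eval_two_layerPoly]

theorem natAbs_eval_zero_layerPoly {n : ℕ} (hn : 1 ≤ n) :
    ((layerPoly n).eval 0).natAbs = 2 := by
  obtain ⟨n, rfl⟩ := Nat.exists_eq_add_of_le' hn
  rw [eval_layerPoly_succ]
  norm_num [natAbs_eval_neg_two_layerPoly]

theorem eval_neg_one_layerPoly (n : ℕ) : (layerPoly n).eval (-1) = -1 := by
  induction n with
  | zero => simp [layerPoly]
  | succ n ih => rw [eval_layerPoly_succ]; norm_num [ih]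

theorem eval_one_layerPoly {n : ℕ} (hn : 1 ≤ n) : (layerPoly n).eval 1 = -1 := by
  obtain ⟨n, rfl⟩ := Nat.exists_eq_add_of_le' hn
  rw [eval_layerPoly_succ]
  norm_num [eval_neg_one_layerPoly]

theorem map_layerPoly_zmod_two (n : ℕ) :
    (layerPoly n).map (Int.castRingHom (ZMod 2)) = Polynomial.X ^ 2 ^ n := by
  induction n with
  | zero => simp [layerPoly]
  | succ n ih =>
    have h : (2 : Polynomial (ZMod 2)) = 0 := CharTwo.two_eq_zero
    rw [layerPoly, Polynomial.map_comp, ih]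
    simp [h, pow_succ', pow_mul]

theorem irreducible_layerPoly {n : ℕ} (hn : 1 ≤ n) : Irreducible (layerPoly n) := by
  have hpr : (Ideal.span {(2 : ℤ)}).IsPrime :=
    (Ideal.span_singleton_prime two_ne_zero).mpr Int.prime_two
  refine Polynomial.IsEisensteinAt.irreducible (𝓟 := Ideal.span {2}) ⟨?_, ?_, ?_⟩ hpr
    (monic_layerPoly n).isPrimitive ?_
  · rw [(monic_layerPoly n).leadingCoeff]
    exact fun h => hpr.ne_top ((Ideal.eq_top_iff_one _).mpr h)
  · intro k hk
    rw [natDegree_layerPoly] at hk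
    have h := congrArg (Polynomial.coeff · k) (map_layerPoly_zmod_two n)
    simp only [Polynomial.coeff_map, Polynomial.coeff_X_pow, hk.ne, if_false] at h
    rw [Ideal.mem_span_singleton]
    exact (ZMod.intCast_zmod_eq_zero_iff_dvd _ 2).mp h
  · rw [Ideal.span_singleton_pow, Ideal.mem_span_singleton, Polynomial.coeff_zero_eq_eval_zero]
    have := natAbs_eval_zero_layerPoly hn
    omega
  · rw [natDegree_layerPoly]; positivity

theorem minpoly_X (n : ℕ) : minpoly ℚ (X n) = (layerPoly n).map (Int.castRingHom ℚ) := by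
  have hm := (monic_layerPoly n).map (Int.castRingHom ℚ)
  refine (minpoly.eq_of_irreducible_of_monic ?_ ?_ hm).symm
  · rcases n with _ | n
    · simpa [layerPoly] using Polynomial.irreducible_X
    · exact ((monic_layerPoly _).irreducible_iff_irreducible_map_fraction_map (K := ℚ)).mp
        (irreducible_layerPoly n.succ_pos)
  · have := aeval_X_layerPoly n
    rwa [← Polynomial.aeval_map_algebraMap ℚ] at this

theorem finrank_B (n : ℕ) : Module.finrank ℚ (B n) = 2 ^ n := by
  rw [B, IntermediateField.adjoin.finrank (isIntegral_X n).tower_top, minpoly_X,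
    (monic_layerPoly n).natDegree_map, natDegree_layerPoly]

/-- `X n` as an algebraic integer of `B n`. -/
noncomputable def intX (n : ℕ) : 𝓞 (B n) :=
  ⟨⟨X n, X_mem_B n⟩, (isIntegral_algebraMap_iff (B := ℝ)
    (algebraMap (B n) ℝ).injective).mp (isIntegral_X n)⟩

/-- The inclusion of the ring of integers of `B n` in the real numbers. -/
noncomputable def toReal (n : ℕ) : 𝓞 (B n) →+* ℝ :=
  (algebraMap (B n) ℝ).comp (algebraMap (𝓞 (B n)) (B n))

theorem toReal_injective (n : ℕ) : Function.Injective (toReal n) :=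
  (algebraMap (B n) ℝ).injective.comp RingOfIntegers.coe_injective

theorem toReal_intX (n : ℕ) : toReal n (intX n) = X n := rfl

theorem aeval_intX_layerPoly (n : ℕ) : Polynomial.aeval (intX n) (layerPoly n) = 0 := by
  apply toReal_injective n
  rw [map_zero, ← aeval_X_layerPoly n, ← toReal_intX]
  exact (Polynomial.aeval_algHom_apply (toReal n).toIntAlgHom (intX n) (layerPoly n)).symm

theorem intX_sub_intCast_dvd (n : ℕ) (a : ℤ) :
    intX n - a ∣ (((layerPoly n).eval a : ℤ) : 𝓞 (B n)) := by
  have h := Polynomial.sub_dvd_eval_sub (intX n) (a : 𝓞 (B n))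
    ((layerPoly n).map (Int.castRingHom (𝓞 (B n))))
  have h0 : ((layerPoly n).map (Int.castRingHom (𝓞 (B n)))).eval (intX n) = 0 := by
    rw [Polynomial.eval_map]; exact aeval_intX_layerPoly n
  rw [h0, zero_sub, dvd_neg, Polynomial.eval_intCast_map] at h
  exact h

theorem isUnit_intX_sub_one {n : ℕ} (hn : 1 ≤ n) : IsUnit (intX n - 1) := by
  have h := intX_sub_intCast_dvd n 1
  rw [eval_one_layerPoly hn] at h
  exact isUnit_of_dvd_unit (by simpa using h) isUnit_one

theorem isUnit_intX_add_one (n : ℕ) : IsUnit (intX n + 1) := by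
  have h := intX_sub_intCast_dvd n (-1)
  rw [eval_neg_one_layerPoly] at h
  exact isUnit_of_dvd_unit (by simpa using h) isUnit_one

theorem two_dvd_intX_pow (n : ℕ) : 2 ∣ intX n ^ 2 ^ n := by
  have h : (Polynomial.C 2 : Polynomial ℤ) ∣ Polynomial.X ^ 2 ^ n - layerPoly n := by
    rw [Polynomial.C_dvd_iff_dvd_coeff]
    intro k
    refine (ZMod.intCast_zmod_eq_zero_iff_dvd _ 2).mp ?_
    have := congrArg (Polynomial.coeff · k) (map_layerPoly_zmod_two n)
    simp only [Polynomial.coeff_map, Polynomial.coeff_X_pow] at this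
    rw [Polynomial.coeff_sub, Int.cast_sub, sub_eq_zero, Polynomial.coeff_X_pow]
    rw [eq_intCast] at this
    rw [this]
    split_ifs <;> simp
  simpa [aeval_intX_layerPoly, map_ofNat] using map_dvd (Polynomial.aeval (intX n)) h

theorem abs_norm_X {n : ℕ} (hn : 1 ≤ n) :
    |Algebra.norm ℚ ((intX n : 𝓞 (B n)) : B n)| = 2 := by
  have hi : IsIntegral ℚ (X n) := (isIntegral_X n).tower_top
  have h := Algebra.PowerBasis.norm_gen_eq_coeff_zero_minpoly (IntermediateField.adjoin.powerBasis hi)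
  rw [IntermediateField.adjoin.powerBasis_gen, IntermediateField.minpoly_gen, minpoly_X,
    Polynomial.coeff_map, Polynomial.coeff_zero_eq_eval_zero] at h
  have h2 : |(((layerPoly n).eval 0 : ℤ) : ℚ)| = 2 := by
    have := natAbs_eval_zero_layerPoly hn
    rw [← Int.cast_abs, Int.abs_eq_natAbs, this]; rfl
  refine (congrArg abs h).trans ?_
  rw [abs_mul, abs_pow, abs_neg, abs_one, one_pow, one_mul]
  exact h2

theorem isReal_of_aeval_layerPoly_eq_zero (n : ℕ) {z : ℂ}
    (hz : Polynomial.aeval z (layerPoly n) = 0) : ∃ r : ℝ, |r| ≤ 2 ∧ z = r := by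
  induction n generalizing z with
  | zero => exact ⟨0, by simp, by simpa [layerPoly] using hz⟩
  | succ n ih =>
    rw [aeval_layerPoly_succ] at hz
    obtain ⟨r, hr, h⟩ := ih hz
    rw [abs_le] at hr
    have hs : (0 : ℝ) ≤ r + 2 := by linarith
    have hz2 : z ^ 2 = ((√(r + 2) : ℝ) : ℂ) ^ 2 := by
      rw [← Complex.ofReal_pow, Real.sq_sqrt hs, Complex.ofReal_add, ← h]
      simp
    have hle : |√(r + 2)| ≤ 2 := by
      rw [abs_of_nonneg (Real.sqrt_nonneg _), Real.sqrt_le_left (by norm_num)]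
      linarith
    rcases sq_eq_sq_iff_eq_or_eq_neg.mp hz2 with h | h
    · exact ⟨_, hle, h⟩
    · exact ⟨-√(r + 2), by rwa [abs_neg], by rw [h, Complex.ofReal_neg]⟩

theorem isReal_algHom_B (n : ℕ) (φ : B n →ₐ[ℚ] ℂ) (x : B n) : ∃ r : ℝ, φ x = r := by
  have hX : ∃ r : ℝ, φ (intX n : 𝓞 (B n)) = r := by
    let ψ : 𝓞 (B n) →+* ℂ := (φ : B n →+* ℂ).comp (algebraMap (𝓞 (B n)) (B n))
    have h := Polynomial.aeval_algHom_apply ψ.toIntAlgHom (intX n) (layerPoly n)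
    rw [aeval_intX_layerPoly, map_zero] at h
    obtain ⟨r, -, hr⟩ := isReal_of_aeval_layerPoly_eq_zero n h
    exact ⟨r, hr⟩
  have h : (Complex.conjAe.restrictScalars ℚ).toAlgHom.comp φ = φ := by
    refine PowerBasis.algHom_ext
      (IntermediateField.adjoin.powerBasis (K := ℚ) (isIntegral_X n).tower_top) ?_
    rw [IntermediateField.adjoin.powerBasis_gen]
    obtain ⟨r, hr⟩ := hX
    change (starRingEnd ℂ) (φ (intX n : 𝓞 (B n))) = φ (intX n : 𝓞 (B n))
    rw [hr, Complex.conj_ofReal]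
  exact Complex.conj_eq_iff_real.mp (DFunLike.congr_fun h x)


/-- `B n` as an extension of `B (n - 1)`. -/
noncomputable local instance predAlgebra (n : ℕ) : Algebra (B (n - 1)) (B n) :=
  (IntermediateField.inclusion (B_pred_le n)).toRingHom.toAlgebra

noncomputable local instance predModule (n : ℕ) : Module (B (n - 1)) (B n) :=
  (predAlgebra n).toModule

theorem mem_relUnits_iff (n : ℕ) (u : (𝓞 (B n))ˣ) :
    u ∈ relUnits n ↔ Algebra.norm (B (n - 1)) ((u : 𝓞 (B n)) : B n) = 1 := by
  rw [relUnits, MonoidHom.mem_ker, Units.ext_iff, RingOfIntegers.ext_iff]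
  rfl

theorem finrank_pred {n : ℕ} (hn : 1 ≤ n) :
    Module.finrank (B (n - 1)) (B n) = 2 := by
  have h := Module.finrank_mul_finrank ℚ (B (n - 1)) (B n)
  obtain ⟨n, rfl⟩ := Nat.exists_eq_add_of_le' hn
  rw [finrank_B, finrank_B, pow_succ] at h
  exact Nat.eq_of_mul_eq_mul_left (by positivity) h

theorem X_notMem_B_pred {n : ℕ} (hn : 1 ≤ n) : X n ∉ B (n - 1) := by
  intro h
  have hle : B n ≤ B (n - 1) := by
    refine IntermediateField.adjoin_le_iff.mpr ?_
    rintro x rfl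
    exact h
  have h1 := finrank_B n
  rw [le_antisymm hle (B_pred_le n), finrank_B] at h1
  have := Nat.pow_right_injective le_rfl h1
  omega

theorem one_lt_X {n : ℕ} (hn : 1 ≤ n) : 1 < X n := by
  have h : Real.cos (Real.pi / 3) < Real.cos (Real.pi / 2 ^ (n + 1)) := by
    have h4 : (4 : ℝ) ≤ 2 ^ (n + 1) := by
      calc (4 : ℝ) = 2 ^ 2 := by norm_num
        _ ≤ 2 ^ (n + 1) := pow_le_pow_right₀ one_le_two (by omega)
    apply Real.cos_lt_cos_of_nonneg_of_le_pi
    · positivity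
    · linarith [Real.pi_pos]
    · exact div_lt_div_of_pos_left Real.pi_pos (by norm_num) (by linarith)
  rw [Real.cos_pi_div_three] at h
  rw [X]
  linarith

theorem one_lt_eps {n : ℕ} (hn : 1 ≤ n) : 1 < eps n := by
  have := one_lt_X hn
  rw [eps, one_lt_div (by linarith)]
  linarith

theorem eps_mul {n : ℕ} (hn : 1 ≤ n) : eps n * (X n - 1) = X n + 1 :=
  div_mul_cancel₀ _ (by linarith [one_lt_X hn])

theorem isRelUnit_iff (n : ℕ) (x : ℝ) :
    IsRelUnit n x ↔ ∃ u ∈ relUnits n, toReal n (u : 𝓞 (B n)) = x := Iff.rfl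

theorem IsRelUnit.mul {n : ℕ} {x y : ℝ} (hx : IsRelUnit n x) (hy : IsRelUnit n y) :
    IsRelUnit n (x * y) := by
  rw [isRelUnit_iff] at *
  obtain ⟨u, hu, rfl⟩ := hx
  obtain ⟨v, hv, rfl⟩ := hy
  exact ⟨u * v, mul_mem hu hv, by simp⟩

theorem IsRelUnit.zpow {n : ℕ} {x : ℝ} (hx : IsRelUnit n x) (k : ℤ) : IsRelUnit n (x ^ k) := by
  rw [isRelUnit_iff] at *
  obtain ⟨u, hu, rfl⟩ := hx
  refine ⟨u ^ k, zpow_mem hu k, ?_⟩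
  change ((Units.map (toReal n : 𝓞 (B n) →* ℝ) (u ^ k) : ℝˣ) : ℝ) = _
  rw [map_zpow, Units.val_zpow_eq_zpow_val]
  rfl

theorem mul_intX_sub_one_of_toReal_eq_eps {n : ℕ} (hn : 1 ≤ n) {x : 𝓞 (B n)}
    (hx : toReal n x = eps n) : x * (intX n - 1) = intX n + 1 := by
  apply toReal_injective n
  simp [hx, toReal_intX, eps_mul hn]

theorem algebraMap_intX_pred {n : ℕ} (hn : 1 ≤ n) :
    algebraMap (B (n - 1)) (B n) (intX (n - 1) : 𝓞 (B (n - 1))) =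
      ((intX n : 𝓞 (B n)) : B n) ^ 2 - 2 := by
  obtain ⟨n, rfl⟩ := Nat.exists_eq_add_of_le' hn
  apply Subtype.ext
  change X n = X (n + 1) ^ 2 - 2
  rw [X_sq]
  ring

theorem isRelUnit_eps {n : ℕ} (hn : 1 ≤ n) : IsRelUnit n (eps n) := by
  obtain ⟨a, ha⟩ := isUnit_intX_sub_one hn
  obtain ⟨b, hb⟩ := isUnit_intX_add_one n
  have hval : toReal n ((b * a⁻¹ : (𝓞 (B n))ˣ) : 𝓞 (B n)) = eps n := by
    have h1 : ((b * a⁻¹ : (𝓞 (B n))ˣ) : 𝓞 (B n)) * (intX n - 1) = intX n + 1 := by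
      rw [← ha, ← hb, Units.val_mul, Units.inv_mul_cancel_right]
    have h2 := congrArg (toReal n) h1
    simp only [map_mul, map_sub, map_add, map_one, toReal_intX] at h2
    rw [eps, eq_div_iff (by linarith [one_lt_X hn]), h2]
  refine ⟨b * a⁻¹, ?_, hval⟩
  generalize b * a⁻¹ = u at hval
  rw [mem_relUnits_iff]
  have hu := congrArg (algebraMap (𝓞 (B n)) (B n)) (mul_intX_sub_one_of_toReal_eq_eps hn hval)
  simp only [map_mul, map_sub, map_add, map_one] at hu
  have hq := sq_sub_trace_mul_add_norm_eq_zero (finrank_pred hn) ((u : 𝓞 (B n)) : B n)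
  have hY := algebraMap_intX_pred hn
  have hY1 : ((intX (n - 1) : 𝓞 (B (n - 1))) : B (n - 1)) + 1 ≠ 0 := by
    have := RingOfIntegers.coe_ne_zero_iff.mpr (isUnit_intX_add_one (n - 1)).ne_zero
    rwa [map_add, map_one] at this
  set x : B n := ((u : 𝓞 (B n)) : B n) with hxdef
  set z : B n := ((intX n : 𝓞 (B n)) : B n)
  set y : B (n - 1) := ((intX (n - 1) : 𝓞 (B (n - 1))) : B (n - 1))
  have hz1 : z - 1 ≠ 0 := by
    have := RingOfIntegers.coe_ne_zero_iff.mpr (isUnit_intX_sub_one hn).ne_zero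
    rwa [map_sub, map_one] at this
  have hquad : (algebraMap (B (n - 1)) (B n) y + 1) * (x ^ 2 + 1) =
      2 * (algebraMap (B (n - 1)) (B n) y + 3) * x := by
    rw [hY]
    have hx : x = (z + 1) / (z - 1) := by rw [eq_div_iff hz1, hu]
    rw [hx]
    field_simp
    ring
  set t := Algebra.trace (B (n - 1)) (B n) x
  set N := Algebra.norm (B (n - 1)) x
  have hlin : algebraMap (B (n - 1)) (B n) (2 * (y + 3) - (y + 1) * t) * x =
      algebraMap (B (n - 1)) (B n) ((y + 1) * (1 - N)) := by
    simp only [map_mul, map_sub, map_add, map_one, map_ofNat]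
    linear_combination (algebraMap (B (n - 1)) (B n) y + 1) * hq - hquad
  by_cases hc : 2 * (y + 3) - (y + 1) * t = 0
  · rw [hc, map_zero, zero_mul, eq_comm, map_eq_zero] at hlin
    exact (sub_eq_zero.mp ((mul_eq_zero.mp hlin).resolve_left hY1)).symm
  · exfalso
    have hx : x = algebraMap (B (n - 1)) (B n)
        ((y + 1) * (1 - N) / (2 * (y + 3) - (y + 1) * t)) := by
      rw [map_div₀, eq_div_iff (by simpa only [ne_eq, map_eq_zero] using hc), mul_comm]
      exact hlin
    have hmem : eps n ∈ B (n - 1) := by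
      have h : ((x : B n) : ℝ) ∈ B (n - 1) := by
        rw [hx]
        exact Subtype.property (p := (· ∈ B (n - 1)))
          ((y + 1) * (1 - N) / (2 * (y + 3) - (y + 1) * t))
      rwa [show ((x : B n) : ℝ) = eps n from hval] at h
    refine X_notMem_B_pred hn ?_
    have hX : X n = (eps n + 1) / (eps n - 1) := by
      rw [eq_div_iff (by linarith [one_lt_eps hn])]
      linear_combination eps_mul hn
    rw [hX]
    exact div_mem (add_mem hmem (one_mem _)) (sub_mem hmem (one_mem _))

theorem abs_norm_eq_one_of_isUnit {K : Type*} [Field K] [NumberField K] {x : 𝓞 K}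
    (hx : IsUnit x) : |Algebra.norm ℚ (x : K)| = 1 := by
  rw [← RingOfIntegers.coe_norm]
  exact NumberField.isUnit_iff_norm.mp hx

theorem norm_algebraMap_eq_pow_finrank {F K L : Type*} [Field F] [Field K] [Field L] [Algebra F K]
    [Algebra F L] [Algebra K L] [IsScalarTower F K L] [FiniteDimensional F K] (t : K) :
    Algebra.norm F (algebraMap K L t) = Algebra.norm F t ^ Module.finrank K L := by
  rw [← Algebra.norm_norm (S := K), Algebra.norm_algebraMap, map_pow]

theorem sq_ne_two_of_rat (q : ℚ) : q ^ 2 ≠ 2 := by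
  intro h
  refine irrational_sqrt_two ⟨|q|, ?_⟩
  rw [eq_comm, Real.sqrt_eq_iff_mul_self_eq (by norm_num) (by positivity), ← pow_two]
  have : |q| ^ 2 = 2 := by rw [sq_abs, h]
  exact_mod_cast this.symm

theorem not_isRelUnit_of_sq_eq_eps {n : ℕ} (hn : 1 ≤ n) {x : ℝ} (hx : x ^ 2 = eps n) :
    ¬ IsRelUnit n x := by
  rintro ⟨u, hu, rfl⟩
  rw [mem_relUnits_iff] at hu
  have hq := sq_sub_trace_mul_add_norm_eq_zero (finrank_pred hn) ((u : 𝓞 (B n)) : B n)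
  rw [hu, map_one] at hq
  have he := congrArg (algebraMap (𝓞 (B n)) (B n)) (mul_intX_sub_one_of_toReal_eq_eps hn
    (x := (u : 𝓞 (B n)) ^ 2) (by rw [map_pow]; exact hx))
  simp only [map_mul, map_pow, map_sub, map_add, map_one] at he
  have hp := abs_norm_eq_one_of_isUnit (isUnit_intX_add_one n)
  have hm := abs_norm_eq_one_of_isUnit (isUnit_intX_sub_one hn)
  have hX := abs_norm_X hn
  simp only [map_sub, map_add, map_one] at hp hm
  generalize Algebra.trace (B (n - 1)) (B n) _ = t at hq
  set y : B n := ((u : 𝓞 (B n)) : B n)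
  set z : B n := ((intX n : 𝓞 (B n)) : B n)
  change |Algebra.norm ℚ (z + 1)| = 1 at hp
  change |Algebra.norm ℚ (z - 1)| = 1 at hm
  have hrel : algebraMap (B (n - 1)) (B n) t ^ 2 * ((z + 1) * (z - 1)) =
      algebraMap ℚ (B n) 4 * z ^ 2 := by
    have h1 : algebraMap (B (n - 1)) (B n) t * y = y ^ 2 + 1 := by linear_combination -hq
    have h2 : (y ^ 2 + 1) * (z - 1) = 2 * z := by linear_combination he
    rw [map_ofNat, ← he]
    calc _ = ((algebraMap (B (n - 1)) (B n) t * y) * (z - 1)) ^ 2 := by ring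
      _ = _ := by rw [h1, h2]; ring
  have hN := congrArg (fun w => |Algebra.norm ℚ w|) hrel
  simp only [map_mul, map_pow, abs_mul, abs_pow, hp, hm, hX] at hN
  rw [norm_algebraMap_eq_pow_finrank, finrank_pred hn, Algebra.norm_algebraMap, finrank_B,
    abs_pow] at hN
  generalize Algebra.norm ℚ t = s at hN
  obtain ⟨n, rfl⟩ := Nat.exists_eq_add_of_le' hn
  have h2 : |s| ^ 2 = 2 * (2 ^ 2 ^ n) ^ 2 := by
    refine (sq_eq_sq₀ (by positivity) (by positivity)).mp ?_
    rw [mul_one, mul_one] at hN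
    rw [hN, abs_of_pos (by positivity), show (4 : ℚ) = 2 ^ 2 by norm_num, ← pow_mul, pow_succ 2 n,
      mul_pow, ← pow_mul, ← pow_mul, mul_comm, show 2 * (2 ^ n * 2) = 2 ^ n * (2 * 2) by ring]
  refine sq_ne_two_of_rat (|s| / 2 ^ 2 ^ n) ?_
  rw [div_pow, h2, mul_div_cancel_right₀ _ (by positivity)]

theorem not_isRelUnit_of_pow_eq_eps {n : ℕ} (hn : 1 ≤ n) {x : ℝ} {m : ℕ} (hm : 2 ≤ m)
    (hx : x ^ m = eps n) : ¬ IsRelUnit n x := by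
  intro h
  rcases Nat.even_or_odd' m with ⟨c, rfl | rfl⟩
  · refine not_isRelUnit_of_sq_eq_eps hn (x := x ^ c) (by rw [← pow_mul, mul_comm, hx]) ?_
    simpa using h.zpow c
  · obtain ⟨u, -, rfl⟩ := h
    refine not_pow_sub_one_dvd_of_odd (isReal_algHom_B n) (abs_norm_X hn) (two_dvd_intX_pow n) u hm
      ⟨c, rfl⟩ ⟨(intX n - 1) ^ 2, ?_⟩
    have he := mul_intX_sub_one_of_toReal_eq_eps hn (x := (u : 𝓞 (B n)) ^ (2 * c + 1))
      (by rw [map_pow]; exact hx)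
    rw [← pow_mul, mul_comm 2, pow_mul, sub_mul, ← mul_pow, he]
    ring

theorem isRelUnit_rpow_inv {n : ℕ} (hn : 1 ≤ n) {l : ℤ} {m : ℕ} (hm : 0 < m)
    (hlm : IsCoprime l (m : ℤ)) (h : IsRelUnit n (eps n ^ ((l : ℝ) / (m : ℝ)))) :
    IsRelUnit n (eps n ^ ((m : ℝ)⁻¹)) := by
  obtain ⟨a, b, hab⟩ := hlm
  have hpos : 0 < eps n := one_pos.trans (one_lt_eps hn)
  have hab' : (a : ℝ) * l + b * m = 1 := by exact_mod_cast hab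
  have : eps n ^ ((m : ℝ)⁻¹) = (eps n ^ ((l : ℝ) / (m : ℝ))) ^ a * eps n ^ b := by
    rw [← Real.rpow_intCast, ← Real.rpow_intCast, ← Real.rpow_mul hpos.le, ← Real.rpow_add hpos]
    congr 1
    field_simp
    linear_combination -hab'
  rw [this]
  exact (h.zpow a).mul ((isRelUnit_eps hn).zpow b)

end WeberUnits

theorem mainTheorem3 (n : ℕ) (hn : 1 ≤ n) :
    WeberUnits.IsRelUnit n (WeberUnits.eps n) ∧
      ∀ (l : ℤ) (m : ℕ), 0 < m → IsCoprime l (m : ℤ) → l ≠ 0 → |(l : ℝ) / (m : ℝ)| < 1 →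
        ¬ WeberUnits.IsRelUnit n (WeberUnits.eps n ^ ((l : ℝ) / (m : ℝ))) := by
  refine ⟨WeberUnits.isRelUnit_eps hn, fun l m hm hlm hl hlt h => ?_⟩
  have hm2 : 2 ≤ m := by
    have hm0 : (0 : ℝ) < m := by exact_mod_cast hm
    rw [abs_div, abs_of_pos hm0, div_lt_one hm0] at hlt
    have h1 : |l| < (m : ℤ) := by exact_mod_cast hlt
    have := Int.one_le_abs hl
    omega
  refine WeberUnits.not_isRelUnit_of_pow_eq_eps hn hm2 ?_
    (WeberUnits.isRelUnit_rpow_inv hn hm hlm h)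
  exact Real.rpow_inv_natCast_pow (one_pos.trans (WeberUnits.one_lt_eps hn)).le hm.ne'
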